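/- Let $n\ge 1$. Draw Ferrers diagrams in English convention (rows left-justified, row lengths weakly decreasing downwards). The border edges of a Ferrers diagram are the vertical edges at the right ends of its rows and the horizontal edges at the bottoms of its columns; their number is the half-perimeter. A labeled tree-like tableau (LTLT) of size $n$ is a Ferrers diagram of half-perimeter $n+1$ in which some boxes and all border edges are labeled with $1,\alpha,\beta,\gamma,\delta$ such that: (i) the Northwestern-most box is labeled by $1$; (ii) the labels in the first row and the first column (including the vertical border edge of the first row and the horizontal border edge of the first column) are exactly the labels equal to $1$; (iii) each row and each column contains a labeled box; (iv) for each box labeled by $\alpha$ or $\gamma$, all boxes above it in its column are unlabeled and at least one box to its left in its row is labeled; (v) for each box labeled by $\beta$ or $\delta$, all boxes to its left in its row are unlabeled and at least one box above it in its column is labeled; (vi) no vertical border edge is labeled by $\beta$ or $\delta$, and no horizontal border edge is labeled by $\alpha$ or $\gamma$. A compatible bi-label for a border edge $e$ is a pair $(x,y)$ of labels with: $x=1$, $y\in\{\beta,\delta\}$ if $e$ is the vertical edge of the first row; $x\in\{\alpha,\gamma\}$, $y=1$ if $e$ is the horizontal edge of the first column; and $x\in\{\alpha,\gamma\}$, $y\in\{\beta,\delta\}$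 otherwise. The special box of an LTLT is the Northeast-most labeled box among those that occur at the bottom of a column. Given an LTLT $T$ of size $n$, a border edge $e$ of $T$ and a compatible bi-label $(x,y)$, the insertion algorithm does the following. 1. Find the special box $s$ of $T$. 2. If $e$ is the vertical edge at the end of row $r$, with label $\ell$, insert a new column immediately to the right of $e$, made of one box in row $r$ and one in each row above it, shifting what lies to the right of $e$ (boxes, border edges and their labels) by one column; label the new box of row $r$ by $\ell$, leave the other new boxes empty, and label the new vertical border edge of row $r$ by $x$ and the horizontal border edge of the new column by $y$; the other border edges keep their labels. If $e$ is horizontal, insert a new row in the mirror-image way: the new box directly below $e$ receives the label of $e$, and its vertical and horizontal border edges receive $x$ and $y$, respectively. 3. If $e$ lies to the left of $s$, add the ribbon (connected strip of empty boxes without $2\times2$ square) along the border that starts just to the right of the new labeled box and ends just below $s$ (in its possibly shifted position); the labels of the border edges stay with their rows and columns. Then the insertion algorithm is a bijection from the set of triples consisting of an LTLT $T$ of size $n$, a border edge $e$ of $T$ and a compatible bi-label $(x,y)$ for $e$, onto the set of LTLTs of size $n+1$. -/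

import Mathlib

namespace LTLT

/-- The labels used in labeled tree-like tableaux: `1, α, β, γ, δ`. -/
inductive Label where
  | one
  | alpha
  | beta
  | gamma
  | delta
  deriving DecidableEq

/-- A Ferrers diagram (English convention, `(i, j)` is the box in row `i` and column `j`, both counted
from `0` at the Northwest corner), a partial labeling of its boxes and a labeling of its border edges.
Row `i` ends in a vertical border edge, whose label is `vEdge i`; column `j` ends in a horizontal
border edge, whose label is `hEdge j`. The value `none` stands for the absence of a label. -/
@[ext] structure Tableau where
  shape : YoungDiagram
  box : ℕ → ℕ → Option Label
  vEdge : ℕ → Option Label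
  hEdge : ℕ → Option Label

/-- `T` is a labeled tree-like tableau of size `n`. -/
structure IsLTLT (n : ℕ) (T : Tableau) : Prop where
  /-- The half-perimeter (number of rows plus number of columns) is `n + 1`. -/
  halfPerimeter : T.shape.colLen 0 + T.shape.rowLen 0 = n + 1
  /-- Only boxes of the diagram carry labels. -/
  mem_of_label : ∀ i j, (T.box i j).isSome → (i, j) ∈ T.shape
  /-- Exactly the vertical border edges (one for each row) carry a label ... -/
  vEdge_isSome : ∀ i, (T.vEdge i).isSome ↔ i < T.shape.colLen 0
  /-- ... and exactly the horizontal ones (one for each column). -/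
  hEdge_isSome : ∀ j, (T.hEdge j).isSome ↔ j < T.shape.rowLen 0
  /-- The root box is labeled by `1`. -/
  root : T.box 0 0 = some .one
  /-- The labels in the first row and the first column are the only labels `1` (boxes). -/
  box_one : ∀ i j l, T.box i j = some l → (l = .one ↔ i = 0 ∨ j = 0)
  /-- The same for the border edges. -/
  vEdge_one : ∀ i l, T.vEdge i = some l → (l = .one ↔ i = 0)
  hEdge_one : ∀ j l, T.hEdge j = some l → (l = .one ↔ j = 0)
  /-- Each row contains a labeled box. -/
  row_labeled : ∀ i < T.shape.colLen 0, ∃ j, (T.box i j).isSome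
  /-- Each column contains a labeled box. -/
  col_labeled : ∀ j < T.shape.rowLen 0, ∃ i, (T.box i j).isSome
  /-- A box labeled by `α` or `γ` has no label above it and some label to its left. -/
  box_alpha_gamma : ∀ i j, T.box i j = some .alpha ∨ T.box i j = some .gamma →
    (∀ i' < i, T.box i' j = none) ∧ ∃ j' < j, (T.box i j').isSome
  /-- A box labeled by `β` or `δ` has no label to its left and some label above it. -/
  box_beta_delta : ∀ i j, T.box i j = some .beta ∨ T.box i j = some .delta →
    (∀ j' < j, T.box i j' = none) ∧ ∃ i' < i, (T.box i' j).isSome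
  /-- A vertical border edge is not labeled by `β` or `δ`: every row has a labeled box, so that the
  condition on `β` and `δ` (no label to the left) would fail for it. -/
  vEdge_ne : ∀ i, T.vEdge i ≠ some .beta ∧ T.vEdge i ≠ some .delta
  /-- Likewise, a horizontal border edge is not labeled by `α` or `γ`. -/
  hEdge_ne : ∀ j, T.hEdge j ≠ some .alpha ∧ T.hEdge j ≠ some .gamma

/-- Border edges: the vertical edge at the end of a row, or the horizontal edge at the bottom of a
column. -/
inductive Edge where
  | vert (row : ℕ)
  | horiz (col : ℕ)
  deriving DecidableEq

/-- `e` is a border edge of the diagram `μ`. -/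
def IsBorderEdge (μ : YoungDiagram) : Edge → Prop
  | .vert r => r < μ.colLen 0
  | .horiz c => c < μ.rowLen 0

/-- `(x, y)` is a compatible bi-label for the border edge `e`. -/
def Compatible : Edge → Label × Label → Prop
  | .vert 0, (x, y) => x = .one ∧ (y = .beta ∨ y = .delta)
  | .horiz 0, (x, y) => (x = .alpha ∨ x = .gamma) ∧ y = .one
  | _, (x, y) => (x = .alpha ∨ x = .gamma) ∧ (y = .beta ∨ y = .delta)

/-- Add one cell to row `r` and to each row above it. -/
def addColumnShape (μ : YoungDiagram) (r : ℕ) : YoungDiagram where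
  cells := μ.cells ∪ (Finset.range (r + 1)).image fun i => (i, μ.rowLen i)
  isLowerSet := by
    rintro ⟨i, j⟩ ⟨i', j'⟩ ⟨hi, hj⟩ h
    simp only [Finset.coe_union, Finset.coe_image, Set.mem_union, Finset.mem_coe,
      YoungDiagram.mem_cells, Set.mem_image, Finset.mem_range, Prod.mk.injEq] at h ⊢
    dsimp only at hi hj
    have hanti := μ.rowLen_anti i' i hi
    rcases h with h | ⟨a, ha, rfl, rfl⟩
    · exact Or.inl (μ.up_left_mem hi hj h)
    · rcases Nat.lt_or_ge j' (μ.rowLen i') with h' | h'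
      · exact Or.inl (YoungDiagram.mem_iff_lt_rowLen.2 h')
      · exact Or.inr ⟨i', by omega, rfl, by omega⟩

/-- Add one cell to column `c` and to each column to its left. -/
def addRowShape (μ : YoungDiagram) (c : ℕ) : YoungDiagram where
  cells := μ.cells ∪ (Finset.range (c + 1)).image fun j => (μ.colLen j, j)
  isLowerSet := by
    rintro ⟨i, j⟩ ⟨i', j'⟩ ⟨hi, hj⟩ h
    simp only [Finset.coe_union, Finset.coe_image, Set.mem_union, Finset.mem_coe,
      YoungDiagram.mem_cells, Set.mem_image, Finset.mem_range, Prod.mk.injEq] at h ⊢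
    dsimp only at hi hj
    have hanti := μ.colLen_anti j' j hj
    rcases h with h | ⟨a, ha, rfl, rfl⟩
    · exact Or.inl (μ.up_left_mem hi hj h)
    · rcases Nat.lt_or_ge i' (μ.colLen j') with h' | h'
      · exact Or.inl (YoungDiagram.mem_iff_lt_colLen.2 h')
      · exact Or.inr ⟨j', by omega, by omega, rfl⟩

/-- Column addition at the vertical border edge of row `r` with new labels `(x, y)`: the new column
is inserted immediately to the right of this edge, reaches from row `0` down to row `r`, and what lies
to the right of it is shifted by one column. Its only labeled box is the one in row `r`, which
receives the old label of the edge; the new vertical and horizontal border edges of this box are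
labeled by `x` and `y`. -/
def addColumn (T : Tableau) (r : ℕ) (x y : Label) : Tableau where
  shape := addColumnShape T.shape r
  box i j :=
    if j < T.shape.rowLen r then T.box i j
    else if j = T.shape.rowLen r then (if i = r then T.vEdge r else none)
    else T.box i (j - 1)
  vEdge i := if i = r then some x else T.vEdge i
  hEdge j :=
    if j < T.shape.rowLen r then T.hEdge j
    else if j = T.shape.rowLen r then some y
    else T.hEdge (j - 1)

/-- Row addition at the horizontal border edge of column `c` with new labels `(x, y)`: the mirror
image of column addition, where again `x` labels the new vertical and `y` the new horizontal border
edge of the new labeled box. -/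
def addRow (T : Tableau) (c : ℕ) (x y : Label) : Tableau where
  shape := addRowShape T.shape c
  box i j :=
    if i < T.shape.colLen c then T.box i j
    else if i = T.shape.colLen c then (if j = c then T.hEdge c else none)
    else T.box (i - 1) j
  vEdge i :=
    if i < T.shape.colLen c then T.vEdge i
    else if i = T.shape.colLen c then some x
    else T.vEdge (i - 1)
  hEdge j := if j = c then some y else T.hEdge j

/-- Add to `μ` the ribbon that starts just to the right of the last box of row `a` and ends, in the
Northeast, just below the last box of column `b`. It consists of the boxes outside `μ`, in rows and
columns of `μ`, whose diagonal neighbor to the Northwest is in `μ`, and which lie weakly North of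
row `a` and weakly West of column `b`. -/
def addRibbonShape (μ : YoungDiagram) (a b : ℕ) : YoungDiagram where
  cells := μ.cells ∪ (Finset.range (a + 1) ×ˢ Finset.range (b + 1)).filter fun p =>
    p ∉ μ ∧ (p.1, 0) ∈ μ ∧ (0, p.2) ∈ μ ∧ (p.1 - 1, p.2 - 1) ∈ μ
  isLowerSet := by
    rintro ⟨i, j⟩ ⟨i', j'⟩ ⟨hi, hj⟩ h
    simp only [Finset.coe_union, Set.mem_union, Finset.mem_coe, YoungDiagram.mem_cells,
      Finset.mem_filter, Finset.mem_product, Finset.mem_range] at h ⊢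
    dsimp only at hi hj
    by_cases h' : (i', j') ∈ μ
    · exact Or.inl h'
    · rcases h with h | ⟨⟨ha, hb⟩, -, h0, h1, h2⟩
      · exact Or.inl (μ.up_left_mem hi hj h)
      · exact Or.inr ⟨⟨by omega, by omega⟩, h', μ.up_left_mem hi le_rfl h0,
          μ.up_left_mem le_rfl hj h1, μ.up_left_mem (by omega) (by omega) h2⟩

/-- Ribbon addition between the vertical border edge of row `a` and the horizontal border edge of
column `b`: the new boxes are empty, and the labels of border edges follow their rows and columns. -/
def addRibbon (T : Tableau) (a b : ℕ) : Tableau :=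
  { T with shape := addRibbonShape T.shape a b }

/-- Column `j` of `T` exists and its bottom box is labeled. -/
def BottomLabeled (T : Tableau) (j : ℕ) : Prop :=
  j < T.shape.rowLen 0 ∧ (T.box (T.shape.colLen j - 1) j).isSome

instance (T : Tableau) : DecidablePred (BottomLabeled T) :=
  fun j => inferInstanceAs (Decidable (j < T.shape.rowLen 0 ∧ _))

/-- The column of the special box: the rightmost column whose bottom box is labeled (so that this box
is the Northeast-most labeled box among the bottom boxes of the columns). -/
def specialColumn (T : Tableau) : ℕ :=
  Nat.findGreatest (BottomLabeled T) (T.shape.rowLen 0)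

/-- The special box: the bottom box of that column. -/
def specialBox (T : Tableau) : ℕ × ℕ :=
  (T.shape.colLen (specialColumn T) - 1, specialColumn T)

/-- The border edge `e` of `μ` lies to the left of the bottom box `s` of a column. -/
def Edge.LeftOf (μ : YoungDiagram) (s : ℕ × ℕ) : Edge → Prop
  | .vert r => μ.rowLen r ≤ s.2
  | .horiz c => c < s.2

instance (μ : YoungDiagram) (s : ℕ × ℕ) (e : Edge) : Decidable (e.LeftOf μ s) :=
  match e with
  | .vert r => inferInstanceAs (Decidable (μ.rowLen r ≤ s.2))
  | .horiz c => inferInstanceAs (Decidable (c < s.2))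

/-- The insertion algorithm: find the special box `s`, add a column (or row) at the edge `e`, and, if
`e` is to the left of `s`, add a ribbon from the right of the new labeled box to the place just below
`s`. A column that is added to the left of `s` shifts `s` by one column. -/
def insertion (T : Tableau) (e : Edge) (xy : Label × Label) : Tableau :=
  let s := specialBox T
  match e with
  | .vert r =>
    if (Edge.vert r).LeftOf T.shape s then addRibbon (addColumn T r xy.1 xy.2) r (s.2 + 1)
    else addColumn T r xy.1 xy.2
  | .horiz c =>
    if (Edge.horiz c).LeftOf T.shape s then
      addRibbon (addRow T c xy.1 xy.2) (T.shape.colLen c) s.2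
    else addRow T c xy.1 xy.2

/-- The inputs of the algorithm: an LTLT of size `n`, one of its border edges, and a compatible
bi-label. -/
def insertionInputs (n : ℕ) : Set (Tableau × Edge × (Label × Label)) :=
  {p | IsLTLT n p.1 ∧ IsBorderEdge p.1.shape p.2.1 ∧ Compatible p.2.1 p.2.2}

end LTLT

namespace LTLT

/-! Insertion is a composite of two bijections, with the pairs (LTLT `A` of size `n + 1`, labeled
corner of `A`) in the middle; a labeled corner is a labeled box that ends both its row and its
column.

Adding a column or row at `e` yields such a pair, the corner being the new box. Conversely, the
label of a corner `(a, c)` tells what was added. If it is `α` or `γ`, or `1` with `c > 0`, the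
corner is the only labeled box of its column and its row keeps a label further left, so the column
can be deleted (`IsLTLT.box_corner_column`). Otherwise the mirror image applies and the row can be
deleted. The remaining corner, the root, is excluded by `1 ≤ n`. This is `IsLTLT.addAtEdge_inj` and
`IsLTLT.exists_addAtEdge_eq`.

The second map adds to `A` the ribbon from the corner `(a, c)` to the special column `b` of `A`. If
`e` is not left of the old special box, then `b = c` and the ribbon is empty, so both branches of
the algorithm have this form (`IsLTLT.insertion_eq`). The corner becomes the special box of the
result (`IsSpecial.addRibbon`), hence can be read off. So can `b`: it is `c` if no box lies to the
right of the corner, and otherwise the first column after `c` with a labeled box on the rim. Finally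
the ribbon is determined by `c`, `b` and the result (`mem_iff_mem_addRibbon`). Removing it from an
arbitrary LTLT gives surjectivity (`IsLTLT.exists_addRibbon_eq`). -/

/-- The box `(i, j)` of `T` is labeled. -/
abbrev Labeled (T : Tableau) (i j : ℕ) : Prop := (T.box i j).isSome

/-- `(a, c)` is a labeled box of `T` that ends both its row and its column. -/
structure IsLabeledCorner (T : Tableau) (a c : ℕ) : Prop where
  labeled : Labeled T a c
  below : (a + 1, c) ∉ T.shape
  right : (a, c + 1) ∉ T.shape

/-! ### Diagrams with a column added or deleted. -/

section Shapes

variable {μ : YoungDiagram}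

theorem mem_addColumnShape {r i j : ℕ} :
    (i, j) ∈ addColumnShape μ r ↔ j < μ.rowLen i + if i ≤ r then 1 else 0 := by
  rw [← YoungDiagram.mem_cells]
  simp only [addColumnShape, Finset.mem_union, YoungDiagram.mem_cells, Finset.mem_image,
    Finset.mem_range, Prod.mk.injEq, YoungDiagram.mem_iff_lt_rowLen]
  constructor
  · rintro (h | ⟨a, h, rfl, rfl⟩)
    · omega
    · rw [if_pos (by omega)]; omega
  · split_ifs with h
    · intro h'
      rcases Nat.lt_or_ge j (μ.rowLen i) with h1 | h1
      · exact Or.inl h1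
      · exact Or.inr ⟨i, by omega, rfl, by omega⟩
    · exact fun h' => Or.inl (by omega)

theorem rowLen_eq_of_mem_iff {i k : ℕ} (h : ∀ j, (i, j) ∈ μ ↔ j < k) : μ.rowLen i = k := by
  have h' : ∀ j, j < μ.rowLen i ↔ j < k := fun j => by
    rw [← YoungDiagram.mem_iff_lt_rowLen, h]
  have h1 := h' k
  have h2 := h' (μ.rowLen i)
  omega

theorem colLen_eq_of_mem_iff {j k : ℕ} (h : ∀ i, (i, j) ∈ μ ↔ i < k) : μ.colLen j = k := by
  have h' : ∀ i, i < μ.colLen j ↔ i < k := fun i => by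
    rw [← YoungDiagram.mem_iff_lt_colLen, h]
  have h1 := h' k
  have h2 := h' (μ.colLen j)
  omega

theorem rowLen_pos_iff {i : ℕ} : 0 < μ.rowLen i ↔ i < μ.colLen 0 := by
  rw [← YoungDiagram.mem_iff_lt_rowLen, YoungDiagram.mem_iff_lt_colLen]

theorem rowLen_addColumnShape {r i : ℕ} :
    (addColumnShape μ r).rowLen i = μ.rowLen i + if i ≤ r then 1 else 0 :=
  rowLen_eq_of_mem_iff fun _ => mem_addColumnShape

theorem colLen_zero_addColumnShape {r : ℕ} (hr : r < μ.colLen 0) :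
    (addColumnShape μ r).colLen 0 = μ.colLen 0 := by
  refine colLen_eq_of_mem_iff fun i => ?_
  rw [mem_addColumnShape, ← rowLen_pos_iff]
  split_ifs with h
  · simp only [rowLen_pos_iff]; omega
  · simp

/-- The position in a diagram of column `j` of the diagram without column `c`. -/
def skipColumn (c j : ℕ) : ℕ := if j < c then j else j + 1

theorem skipColumn_eq_zero_iff {c j : ℕ} (hc : 0 < c) : skipColumn c j = 0 ↔ j = 0 := by
  unfold skipColumn
  constructor
  · intro h
    split_ifs at h
    exact h
  · rintro rfl
    rw [if_pos hc]

/-- Delete column `c` of `μ`. -/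
def deleteColumnShape (μ : YoungDiagram) (c : ℕ) : YoungDiagram where
  -- Filtering `μ.cells` loses nothing, because `j ≤ skipColumn c j`.
  cells := μ.cells.filter fun p => (p.1, skipColumn c p.2) ∈ μ
  isLowerSet := by
    rintro ⟨i, j⟩ ⟨i', j'⟩ ⟨hi, hj⟩ h
    simp only [Finset.coe_filter, YoungDiagram.mem_cells, Set.mem_ofPred_eq] at h ⊢
    dsimp only at hi hj
    refine ⟨μ.up_left_mem hi hj h.1, μ.up_left_mem hi ?_ h.2⟩
    unfold skipColumn
    split_ifs <;> omega

theorem mem_deleteColumnShape {c i j : ℕ} :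
    (i, j) ∈ deleteColumnShape μ c ↔ (i, skipColumn c j) ∈ μ := by
  rw [← YoungDiagram.mem_cells]
  simp only [deleteColumnShape, Finset.mem_filter, YoungDiagram.mem_cells, and_iff_right_iff_imp]
  refine μ.up_left_mem le_rfl ?_
  unfold skipColumn
  split_ifs <;> omega

theorem colLen_zero_deleteColumnShape {c : ℕ} (hc : 0 < c) :
    (deleteColumnShape μ c).colLen 0 = μ.colLen 0 := by
  refine colLen_eq_of_mem_iff fun i => ?_
  rw [mem_deleteColumnShape, skipColumn, if_pos hc, YoungDiagram.mem_iff_lt_colLen]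

theorem rowLen_deleteColumnShape {c i : ℕ} :
    (deleteColumnShape μ c).rowLen i =
      if c < μ.rowLen i then μ.rowLen i - 1 else μ.rowLen i := by
  refine rowLen_eq_of_mem_iff fun j => ?_
  rw [mem_deleteColumnShape, YoungDiagram.mem_iff_lt_rowLen, skipColumn]
  split_ifs <;> omega

end Shapes

/-! ### Column addition on LTLTs and its inverse, column deletion. -/

section Columns

variable {n : ℕ} {T : Tableau}

theorem IsLTLT.box_eq_none (h : IsLTLT n T) {i j : ℕ} (hij : T.shape.rowLen i ≤ j) :
    T.box i j = none := by
  by_contra h'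
  have := h.mem_of_label i j (Option.isSome_iff_ne_none.2 h')
  rw [YoungDiagram.mem_iff_lt_rowLen] at this
  omega

theorem IsLTLT.zero_mem (h : IsLTLT n T) : (0, 0) ∈ T.shape :=
  h.mem_of_label 0 0 (by simp [h.root])

theorem IsLTLT.addColumn (h : IsLTLT n T) {r : ℕ} {x y : Label} (hr : r < T.shape.colLen 0)
    (hx : x = .one ↔ r = 0) (hxb : x ≠ .beta) (hxd : x ≠ .delta) (hy : y = .beta ∨ y = .delta) :
    IsLTLT (n + 1) (addColumn T r x y) := by
  have hpos : 0 < T.shape.rowLen r := rowLen_pos_iff.2 hr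
  have hanti := T.shape.rowLen_anti
  have hr0 := hanti 0 r (Nat.zero_le _)
  have hnone := fun i j => h.box_eq_none (i := i) (j := j)
  have hcol : (LTLT.addColumn T r x y).shape.colLen 0 = T.shape.colLen 0 :=
    colLen_zero_addColumnShape hr
  have hrow : (LTLT.addColumn T r x y).shape.rowLen 0 = T.shape.rowLen 0 + 1 := by
    simp [LTLT.addColumn, rowLen_addColumnShape]
  -- the labels of `T` occur in the new tableau at the shifted position
  have hskip : ∀ i j, (LTLT.addColumn T r x y).box i (skipColumn (T.shape.rowLen r) j) =
      T.box i j := by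
    intro i j
    simp only [LTLT.addColumn, skipColumn]
    split_ifs <;> first | omega | rfl
  have hskip' : ∀ j, j = T.shape.rowLen r ∨ ∃ j', j = skipColumn (T.shape.rowLen r) j' := by
    intro j
    rcases lt_trichotomy j (T.shape.rowLen r) with h' | h' | h'
    · exact Or.inr ⟨j, by simp [skipColumn, h']⟩
    · exact Or.inl h'
    · exact Or.inr ⟨j - 1, by rw [skipColumn, if_neg (by omega)]; omega⟩
  have hnew : ∀ i, (LTLT.addColumn T r x y).box i (T.shape.rowLen r) =
      if i = r then T.vEdge r else none := by
    intro i; simp [LTLT.addColumn]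
  have hmono : ∀ {j j'}, j < j' →
      skipColumn (T.shape.rowLen r) j < skipColumn (T.shape.rowLen r) j' := by
    intro j j' hj
    unfold skipColumn
    split_ifs <;> omega
  have hmono' : ∀ {j j'}, skipColumn (T.shape.rowLen r) j < skipColumn (T.shape.rowLen r) j' →
      j < j' := by
    intro j j' hj
    unfold skipColumn at hj
    split_ifs at hj <;> omega
  have hrowlab : ∃ j' < T.shape.rowLen r, (LTLT.addColumn T r x y).box r j' |>.isSome := by
    obtain ⟨j, hj⟩ := h.row_labeled r hr
    have hj' := YoungDiagram.mem_iff_lt_rowLen.1 (h.mem_of_label r j hj)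
    exact ⟨j, hj', by simpa [LTLT.addColumn, hj'] using hj⟩
  refine ⟨?_, ?_, ?_, ?_, ?_, ?_, ?_, ?_, ?_, ?_, ?_, ?_, ?_, ?_⟩
  · rw [hcol, hrow, ← add_assoc, h.halfPerimeter]
  · intro i j hij
    rw [show (LTLT.addColumn T r x y).shape = addColumnShape T.shape r from rfl,
      mem_addColumnShape]
    rcases hskip' j with rfl | ⟨j, rfl⟩
    · rw [hnew] at hij
      split_ifs at hij with hi
      · subst hi; simp
      · simp at hij
    · rw [hskip] at hij
      have := YoungDiagram.mem_iff_lt_rowLen.1 (h.mem_of_label i j hij)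
      unfold skipColumn
      split_ifs with h1 h2 h2
      · omega
      · omega
      · omega
      · have := hanti r i (by omega)
        omega
  · intro i
    rw [hcol]
    simp only [LTLT.addColumn]
    split_ifs with hi
    · simp [hi, hr]
    · exact h.vEdge_isSome i
  · intro j
    rw [hrow]
    simp only [LTLT.addColumn]
    split_ifs with h1 h2
    · rw [h.hEdge_isSome]; omega
    · simp; omega
    · rw [h.hEdge_isSome]; omega
  · simp [LTLT.addColumn, hpos, h.root]
  · intro i j l hl
    rcases hskip' j with rfl | ⟨j, rfl⟩
    · rw [hnew] at hl
      split_ifs at hl with hi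
      rw [h.vEdge_one r l hl, hi]
      omega
    · rw [hskip] at hl
      rw [h.box_one i j l hl, skipColumn_eq_zero_iff hpos]
  · intro i l hl
    simp only [LTLT.addColumn] at hl
    split_ifs at hl with hi
    · cases hl; rw [hx, hi]
    · exact h.vEdge_one i l hl
  · intro j l hl
    simp only [LTLT.addColumn] at hl
    split_ifs at hl with h1 h2
    · exact h.hEdge_one j l hl
    · cases hl
      have : j ≠ 0 := by omega
      rcases hy with rfl | rfl <;> simp [this]
    · rw [h.hEdge_one _ l hl]; omega
  · intro i hi
    rw [hcol] at hi
    obtain ⟨j, hj⟩ := h.row_labeled i hi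
    exact ⟨_, by rwa [← hskip] at hj⟩
  · intro j hj
    rw [hrow] at hj
    rcases hskip' j with rfl | ⟨j, rfl⟩
    · exact ⟨r, by rw [hnew, if_pos rfl, h.vEdge_isSome]; exact hr⟩
    · have hj' : j < T.shape.rowLen 0 := by
        unfold skipColumn at hj
        split_ifs at hj <;> omega
      obtain ⟨i, hi⟩ := h.col_labeled j hj'
      exact ⟨i, by rwa [hskip]⟩
  · intro i j hl
    rcases hskip' j with rfl | ⟨j, rfl⟩
    · rw [hnew] at hl
      split_ifs at hl with hi
      · subst hi
        exact ⟨fun i' hi' => by rw [hnew, if_neg hi'.ne], hrowlab⟩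
      · simp at hl
    · rw [hskip] at hl
      obtain ⟨h1, j', hj', h2⟩ := h.box_alpha_gamma i j hl
      exact ⟨fun i' hi' => by rw [hskip, h1 i' hi'], _, hmono hj', by rwa [hskip]⟩
  · intro i j hl
    rcases hskip' j with rfl | ⟨j, rfl⟩
    · rw [hnew] at hl
      have := h.vEdge_ne r
      split_ifs at hl with hi
      · tauto
      · simp at hl
    · rw [hskip] at hl
      obtain ⟨h1, i', hi', h2⟩ := h.box_beta_delta i j hl
      refine ⟨fun j' hj' => ?_, i', hi', by rwa [hskip]⟩
      rcases hskip' j' with rfl | ⟨j', rfl⟩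
      · rw [hnew]
        split_ifs with hi
        -- Row `r` of `T` ends at the chosen edge, so no labeled box of this row lies to the right
        -- of the new column.
        · subst hi
          exfalso
          have := hnone i j
          have hle : T.shape.rowLen i ≤ j := by
            by_contra h'
            rw [skipColumn, if_pos (by omega)] at hj'
            omega
          rcases hl with hl | hl <;> simp [this hle] at hl
        · rfl
      · rw [hskip]
        exact h1 _ (hmono' hj')
  · intro i
    simp only [LTLT.addColumn]
    split_ifs with hi
    · simp [hxb, hxd]
    · exact h.vEdge_ne i
  · intro j
    simp only [LTLT.addColumn]
    split_ifs with h1 h2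
    · exact h.hEdge_ne j
    · rcases hy with rfl | rfl <;> simp
    · exact h.hEdge_ne _

theorem IsLTLT.isLabeledCorner_addColumn (h : IsLTLT n T) {r : ℕ} (x y : Label)
    (hr : r < T.shape.colLen 0) :
    IsLabeledCorner (LTLT.addColumn T r x y) r (T.shape.rowLen r) := by
  refine ⟨?_, ?_, ?_⟩
  · simpa [Labeled, LTLT.addColumn, h.vEdge_isSome] using hr
  · have := T.shape.rowLen_anti r (r + 1) (by omega)
    simp [LTLT.addColumn, mem_addColumnShape, this]
  · simp [LTLT.addColumn, mem_addColumnShape]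

/-- Delete column `c`, whose labeled box in row `a` gives its label to the vertical border edge of
this row. -/
def deleteColumn (T : Tableau) (a c : ℕ) : Tableau where
  shape := deleteColumnShape T.shape c
  box i j := T.box i (skipColumn c j)
  vEdge i := if i = a then T.box a c else T.vEdge i
  hEdge j := T.hEdge (skipColumn c j)

theorem IsLTLT.deleteColumn_addColumn (h : IsLTLT n T) (r : ℕ) (x y : Label) :
    deleteColumn (LTLT.addColumn T r x y) r (T.shape.rowLen r) = T := by
  have hnone := fun i j => h.box_eq_none (i := i) (j := j)
  ext1
  · ext ⟨i, j⟩
    rw [YoungDiagram.mem_cells, YoungDiagram.mem_cells]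
    simp only [deleteColumn, LTLT.addColumn, YoungDiagram.mem_iff_lt_rowLen,
      rowLen_deleteColumnShape, rowLen_addColumnShape]
    rcases Nat.lt_or_ge r i with hi | hi
    · have := T.shape.rowLen_anti r i hi.le
      split_ifs <;> omega
    · have := T.shape.rowLen_anti i r hi
      split_ifs <;> omega
  · funext i j
    simp only [deleteColumn, LTLT.addColumn, skipColumn]
    split_ifs <;> first | omega | rfl
  · funext i
    simp only [deleteColumn, LTLT.addColumn]
    split_ifs with h1 <;> simp_all
  · funext j
    simp only [deleteColumn, LTLT.addColumn, skipColumn]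
    split_ifs <;> first | omega | rfl

/-- Below the corner there are no boxes. For `α` and `γ` the rest is their defining condition; a
label `1` with `c > 0` forces `a = 0`, and the root is the label to the left. Hence deleting column
`c` loses one label only and leaves row `a` labeled. -/
theorem IsLTLT.box_corner_column (h : IsLTLT n T) {a c : ℕ} {l : Label}
    (hq : IsLabeledCorner T a c) (hl : T.box a c = some l) (hc : 0 < c) (hb : l ≠ .beta)
    (hd : l ≠ .delta) : (∀ i ≠ a, T.box i c = none) ∧ ∃ j < c, Labeled T a j := by
  have hbelow : ∀ i, a < i → T.box i c = none := fun i hi => by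
    by_contra h'
    exact hq.below (T.shape.up_left_mem hi le_rfl
      (h.mem_of_label i c (Option.isSome_iff_ne_none.2 h')))
  have habove : (∀ i < a, T.box i c = none) ∧ ∃ j < c, Labeled T a j := by
    cases l with
    | one =>
      have := (h.box_one a c _ hl).1 rfl
      obtain rfl : a = 0 := by omega
      exact ⟨by simp, 0, hc, by simp [Labeled, h.root]⟩
    | alpha => exact h.box_alpha_gamma a c (Or.inl hl)
    | gamma => exact h.box_alpha_gamma a c (Or.inr hl)
    | beta => exact absurd rfl hb
    | delta => exact absurd rfl hd
  exact ⟨fun i hi => (lt_or_gt_of_ne hi).elim (habove.1 i) (hbelow i), habove.2⟩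

theorem IsLabeledCorner.rowLen_eq {a c : ℕ} (h : IsLTLT n T) (hq : IsLabeledCorner T a c) :
    T.shape.rowLen a = c + 1 := by
  have h1 := h.mem_of_label a c hq.labeled
  have h2 := hq.right
  rw [YoungDiagram.mem_iff_lt_rowLen] at h1 h2
  omega

theorem IsLTLT.deleteColumn (h : IsLTLT (n + 1) T) {a c : ℕ} {l : Label}
    (hq : IsLabeledCorner T a c) (hl : T.box a c = some l) (hc : 0 < c) (hb : l ≠ .beta)
    (hd : l ≠ .delta) : IsLTLT n (deleteColumn T a c) := by
  obtain ⟨hnone, j₀, hj₀, hlab₀⟩ := h.box_corner_column hq hl hc hb hd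
  have hlen := hq.rowLen_eq h
  have hlen0 := T.shape.rowLen_anti 0 a (Nat.zero_le _)
  have ha : a < T.shape.colLen 0 := rowLen_pos_iff.1 (by omega)
  have hcol : (LTLT.deleteColumn T a c).shape.colLen 0 = T.shape.colLen 0 :=
    colLen_zero_deleteColumnShape hc
  have hrow : (LTLT.deleteColumn T a c).shape.rowLen 0 = T.shape.rowLen 0 - 1 := by
    rw [show (LTLT.deleteColumn T a c).shape = deleteColumnShape T.shape c from rfl,
      rowLen_deleteColumnShape, if_pos (by omega)]
  have hbox : ∀ i j, (LTLT.deleteColumn T a c).box i j = T.box i (skipColumn c j) :=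
    fun _ _ => rfl
  have hskip0 : skipColumn c 0 = 0 := by simp [skipColumn, hc]
  have hskip' : ∀ j, j ≠ c → ∃ j', j = skipColumn c j' := by
    intro j hj
    rcases Nat.lt_or_gt_of_ne hj with h' | h'
    · exact ⟨j, by simp [skipColumn, h']⟩
    · exact ⟨j - 1, by rw [skipColumn, if_neg (by omega)]; omega⟩
  have hmono : ∀ {j j'}, j < j' → skipColumn c j < skipColumn c j' := by
    intro j j' hj
    unfold skipColumn
    split_ifs <;> omega
  have hmono' : ∀ {j j'}, skipColumn c j < skipColumn c j' → j < j' := by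
    intro j j' hj
    unfold skipColumn at hj
    split_ifs at hj <;> omega
  have hzero := fun j => skipColumn_eq_zero_iff (j := j) hc
  have hlt : ∀ j, skipColumn c j < T.shape.rowLen 0 ↔ j < T.shape.rowLen 0 - 1 := by
    intro j
    unfold skipColumn
    split_ifs <;> omega
  refine ⟨?_, ?_, ?_, ?_, ?_, ?_, ?_, ?_, ?_, ?_, ?_, ?_, ?_, ?_⟩
  · rw [hcol, hrow]
    have := h.halfPerimeter
    omega
  · intro i j hij
    exact mem_deleteColumnShape.2 (h.mem_of_label _ _ hij)
  · intro i
    rw [hcol]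
    simp only [LTLT.deleteColumn]
    split_ifs with hi
    · simp [hi, ha, hl]
    · exact h.vEdge_isSome i
  · intro j
    rw [hrow]
    simp only [LTLT.deleteColumn, h.hEdge_isSome, hlt]
  · rw [hbox, hskip0, h.root]
  · intro i j l hl
    rw [h.box_one _ _ l hl, hzero]
  · intro i l' hl'
    simp only [LTLT.deleteColumn] at hl'
    split_ifs at hl' with hi
    · rw [h.box_one _ _ _ hl', hi]; omega
    · exact h.vEdge_one i l' hl'
  · intro j l hl
    rw [h.hEdge_one _ l hl, hzero]
  · intro i hi
    rw [hcol] at hi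
    have key : ∃ j, j ≠ c ∧ (T.box i j).isSome := by
      by_cases hia : i = a
      · exact ⟨j₀, hj₀.ne, hia ▸ hlab₀⟩
      · obtain ⟨j, hj⟩ := h.row_labeled i hi
        refine ⟨j, ?_, hj⟩
        rintro rfl
        simp [hnone i hia] at hj
    obtain ⟨j, hj, hj'⟩ := key
    obtain ⟨j, rfl⟩ := hskip' j hj
    exact ⟨j, hj'⟩
  · intro j hj
    rw [hrow, ← hlt] at hj
    exact h.col_labeled _ hj
  · intro i j hl
    obtain ⟨h1, j', hj', h2⟩ := h.box_alpha_gamma _ _ hl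
    refine ⟨fun i' hi' => h1 i' hi', ?_⟩
    -- The only label of column `c` is in row `a`, and this row has no box to the right of column
    -- `c`, so the label lost by deletion is never needed as a left witness.
    have hne : j' ≠ c := by
      rintro rfl
      have hia : i = a := by
        by_contra hia
        simp [hnone i hia] at h2
      subst hia
      rw [hbox, h.box_eq_none (by omega)] at hl
      simp at hl
    obtain ⟨j', rfl⟩ := hskip' j' hne
    exact ⟨j', hmono' hj', h2⟩
  · intro i j hl
    obtain ⟨h1, h2⟩ := h.box_beta_delta _ _ hl
    exact ⟨fun j' hj' => h1 _ (hmono hj'), h2⟩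
  · intro i
    simp only [LTLT.deleteColumn]
    split_ifs with hi
    · simp [hl, hb, hd]
    · exact h.vEdge_ne i
  · intro j
    exact h.hEdge_ne _

theorem IsLTLT.rowLen_deleteColumn (h : IsLTLT n T) {a c : ℕ} (hq : IsLabeledCorner T a c) :
    (LTLT.deleteColumn T a c).shape.rowLen a = c := by
  have hlen := hq.rowLen_eq h
  simp only [LTLT.deleteColumn, rowLen_deleteColumnShape]
  rw [if_pos (by omega)]; omega

theorem IsLTLT.addColumn_deleteColumn (h : IsLTLT n T) {a c : ℕ} {l x y : Label}
    (hq : IsLabeledCorner T a c) (hl : T.box a c = some l) (hc : 0 < c) (hb : l ≠ .beta)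
    (hd : l ≠ .delta) (hx : T.vEdge a = some x) (hy : T.hEdge c = some y) :
    LTLT.addColumn (LTLT.deleteColumn T a c) a x y = T := by
  obtain ⟨hnone, -⟩ := h.box_corner_column hq hl hc hb hd
  have hlen := hq.rowLen_eq h
  have hlen' := h.rowLen_deleteColumn hq
  ext1
  · ext ⟨i, j⟩
    rw [YoungDiagram.mem_cells, YoungDiagram.mem_cells]
    simp only [LTLT.deleteColumn, LTLT.addColumn, YoungDiagram.mem_iff_lt_rowLen,
      rowLen_deleteColumnShape, rowLen_addColumnShape]
    have hbelow := hq.below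
    rw [YoungDiagram.mem_iff_lt_rowLen] at hbelow
    rcases Nat.lt_or_ge a i with hi | hi
    · have := T.shape.rowLen_anti (a + 1) i hi
      split_ifs <;> omega
    · have := T.shape.rowLen_anti i a hi
      split_ifs <;> omega
  · funext i j
    simp only [LTLT.addColumn, hlen']
    simp only [LTLT.deleteColumn, skipColumn, if_true]
    split_ifs with h1 h2 h3 h4
    · rfl
    · rw [h2, h3]
    · rw [h2, hnone i h3]
    · omega
    · congr 1; omega
  · funext i
    simp only [LTLT.deleteColumn, LTLT.addColumn]
    split_ifs with h1
    · rw [h1, hx]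
    · rfl
  · funext j
    simp only [LTLT.addColumn, hlen']
    simp only [LTLT.deleteColumn, skipColumn]
    split_ifs with h1 h2 h3
    · rfl
    · rw [h2, hy]
    · omega
    · congr 1; omega

end Columns

/-! ### The special box, and ribbons. -/

section Ribbons

variable {n a b c : ℕ} {T : Tableau}

/-- `(a, c)` is the Northeast-most labeled box of `T` at the bottom of a column. -/
structure IsSpecial (T : Tableau) (a c : ℕ) : Prop where
  labeled : Labeled T a c
  below : (a + 1, c) ∉ T.shape
  mem_below : ∀ i j, c < j → Labeled T i j → (i + 1, j) ∈ T.shape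

theorem IsLTLT.mem_zero_of_labeled (h : IsLTLT n T) {i j : ℕ} (hij : Labeled T i j) :
    (0, j) ∈ T.shape :=
  T.shape.up_left_mem (Nat.zero_le _) le_rfl (h.mem_of_label i j hij)

theorem IsLTLT.colLen_of_labeled (h : IsLTLT n T) {i j : ℕ} (hij : Labeled T i j)
    (hb : (i + 1, j) ∉ T.shape) : T.shape.colLen j = i + 1 := by
  have h1 := h.mem_of_label i j hij
  rw [YoungDiagram.mem_iff_lt_colLen] at h1 hb
  omega

theorem IsLTLT.bottomLabeled_iff (h : IsLTLT n T) {j : ℕ} :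
    BottomLabeled T j ↔ ∃ i, Labeled T i j ∧ (i + 1, j) ∉ T.shape := by
  constructor
  · rintro ⟨h1, h2⟩
    refine ⟨_, h2, ?_⟩
    rw [← YoungDiagram.mem_iff_lt_rowLen, YoungDiagram.mem_iff_lt_colLen] at h1
    rw [YoungDiagram.mem_iff_lt_colLen]
    omega
  · rintro ⟨i, h1, h2⟩
    refine ⟨YoungDiagram.mem_iff_lt_rowLen.1 (h.mem_zero_of_labeled h1), ?_⟩
    rwa [h.colLen_of_labeled h1 h2]

theorem IsSpecial.specialColumn_eq (h : IsLTLT n T) (hs : IsSpecial T a c) :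
    specialColumn T = c := by
  rw [specialColumn, Nat.findGreatest_eq_iff]
  refine ⟨(YoungDiagram.mem_iff_lt_rowLen.1 (h.mem_zero_of_labeled hs.labeled)).le, fun _ => ?_,
    fun j hj _ hb => ?_⟩
  · exact h.bottomLabeled_iff.2 ⟨a, hs.labeled, hs.below⟩
  · obtain ⟨i, h1, h2⟩ := h.bottomLabeled_iff.1 hb
    exact h2 (hs.mem_below i j hj h1)

theorem IsSpecial.specialBox_eq (h : IsLTLT n T) (hs : IsSpecial T a c) :
    specialBox T = (a, c) := by
  rw [specialBox, hs.specialColumn_eq h, h.colLen_of_labeled hs.labeled hs.below,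
    Nat.add_sub_cancel]

theorem IsLTLT.isSpecial_specialBox (h : IsLTLT n T) :
    IsSpecial T (specialBox T).1 (specialBox T).2 := by
  have h0 := YoungDiagram.mem_iff_lt_colLen.1 h.zero_mem
  -- A special box exists: any labeled box of the last row is at the bottom of its column.
  obtain ⟨j, hj⟩ := h.row_labeled (T.shape.colLen 0 - 1) (by omega)
  have hbot : (T.shape.colLen 0 - 1 + 1, j) ∉ T.shape := by
    rw [YoungDiagram.mem_iff_lt_colLen]
    have := T.shape.colLen_anti 0 j (Nat.zero_le _)
    omega
  have hj' := h.bottomLabeled_iff.2 ⟨_, hj, hbot⟩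
  have hspec : BottomLabeled T (specialColumn T) := Nat.findGreatest_spec hj'.1.le hj'
  obtain ⟨i, h1, h2⟩ := h.bottomLabeled_iff.1 hspec
  rw [specialBox, h.colLen_of_labeled h1 h2, Nat.add_sub_cancel]
  refine ⟨h1, h2, fun i' j' hlt hlab => ?_⟩
  by_contra hnot
  have hb := h.bottomLabeled_iff.2 ⟨i', hlab, hnot⟩
  exact absurd (Nat.le_findGreatest hb.1.le hb) (not_le.2 hlt)

/-- The condition of lying outside `μ` is absorbed by the first disjunct. The truncated subtraction
is harmless: for `i = 0` or `j = 0` the second disjunct already puts the box in `μ`. -/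
theorem mem_addRibbonShape {μ : YoungDiagram} {i j : ℕ} :
    (i, j) ∈ addRibbonShape μ a b ↔ (i, j) ∈ μ ∨
      i ≤ a ∧ j ≤ b ∧ (i, 0) ∈ μ ∧ (0, j) ∈ μ ∧ (i - 1, j - 1) ∈ μ := by
  rw [← YoungDiagram.mem_cells]
  simp only [addRibbonShape, Finset.mem_union, YoungDiagram.mem_cells, Finset.mem_filter,
    Finset.mem_product, Finset.mem_range, Nat.lt_succ_iff]
  tauto

/-- Changing the shape of an LTLT without changing the numbers of rows and columns. -/
theorem IsLTLT.of_shape (h : IsLTLT n T) (μ : YoungDiagram)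
    (hrow : μ.rowLen 0 = T.shape.rowLen 0) (hcol : μ.colLen 0 = T.shape.colLen 0)
    (hmem : ∀ i j, Labeled T i j → (i, j) ∈ μ) : IsLTLT n { T with shape := μ } where
  halfPerimeter := by simpa only [hrow, hcol] using h.halfPerimeter
  mem_of_label := hmem
  vEdge_isSome := by simpa only [hcol] using h.vEdge_isSome
  hEdge_isSome := by simpa only [hrow] using h.hEdge_isSome
  root := h.root
  box_one := h.box_one
  vEdge_one := h.vEdge_one
  hEdge_one := h.hEdge_one
  row_labeled := by simpa only [hcol] using h.row_labeled
  col_labeled := by simpa only [hrow] using h.col_labeled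
  box_alpha_gamma := h.box_alpha_gamma
  box_beta_delta := h.box_beta_delta
  vEdge_ne := h.vEdge_ne
  hEdge_ne := h.hEdge_ne

theorem IsLTLT.addRibbon (h : IsLTLT n T) (a b : ℕ) : IsLTLT n (addRibbon T a b) := by
  refine h.of_shape _ ?_ ?_ fun i j hij => mem_addRibbonShape.2 (Or.inl (h.mem_of_label i j hij))
  · refine rowLen_eq_of_mem_iff fun j => ?_
    rw [mem_addRibbonShape, ← YoungDiagram.mem_iff_lt_rowLen]
    tauto
  · refine colLen_eq_of_mem_iff fun j => ?_
    rw [mem_addRibbonShape, ← YoungDiagram.mem_iff_lt_colLen]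
    tauto

/-- Column `j` of `T` has a labeled box on the rim, that is, without diagonal Southeast neighbor. -/
def RimLabeled (T : Tableau) (j : ℕ) : Prop :=
  ∃ i, (i + 1, j + 1) ∉ T.shape ∧ Labeled T i j

/-- The boxes of the ribbon that starts to the right of column `c` and ends in column `b`,
in terms of the tableau that contains it. -/
def InRibbon (T : Tableau) (c b i j : ℕ) : Prop :=
  c < j ∧ j ≤ b ∧ (i + 1, j + 1) ∉ T.shape ∧ ∀ i', i ≤ i' → ¬ Labeled T i' j

/-! ### What a ribbon added at a labeled corner leaves visible. -/

section AddRibbon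

variable {s : ℕ}

theorem IsLabeledCorner.le_special (hq : IsLabeledCorner T a c) (hs : IsSpecial T s b) : c ≤ b := by
  by_contra hlt
  exact hq.below (hs.mem_below a c (by omega) hq.labeled)

/-- Right of the corner all boxes lie above row `a`, so the diagonal neighbor is within the range of
the ribbon. Thus strictly between columns `c` and `b` no old box stays on the rim. -/
theorem mem_addRibbon_of_mem (h : IsLTLT n T) (hq : IsLabeledCorner T a c)
    (hs : IsSpecial T s b) {i j : ℕ} (hij : (i, j) ∈ T.shape) (hcj : c < j) (hjb : j < b) :
    (i + 1, j + 1) ∈ (addRibbon T a b).shape := by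
  have hia : i < a := by
    by_contra hia
    exact hq.right (T.shape.up_left_mem (by omega) (by omega) hij)
  refine mem_addRibbonShape.2 (Or.inr ⟨hia, hjb, ?_, ?_, hij⟩)
  · exact T.shape.up_left_mem hia (Nat.zero_le _) (h.mem_of_label a c hq.labeled)
  · exact T.shape.up_left_mem (Nat.zero_le _) hjb (h.mem_of_label s b hs.labeled)

/-- The old diagram is recovered from the new one and `c`, `b`. Between these columns the ribbon is
exactly the rim; in column `b` it is what lies below the labeled box that was special. -/
theorem mem_iff_mem_addRibbon (h : IsLTLT n T) (hq : IsLabeledCorner T a c)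
    (hs : IsSpecial T s b) {i j : ℕ} :
    (i, j) ∈ T.shape ↔ (i, j) ∈ (addRibbon T a b).shape ∧ ¬ InRibbon (addRibbon T a b) c b i j := by
  constructor
  · refine fun hij => ⟨mem_addRibbonShape.2 (Or.inl hij), ?_⟩
    rintro ⟨hcj, hjb, hse, hlab⟩
    rcases hjb.lt_or_eq with hjb | rfl
    · exact hse (mem_addRibbon_of_mem h hq hs hij hcj hjb)
    · rcases Nat.lt_or_ge s i with hi | hi
      · exact hs.below (T.shape.up_left_mem hi le_rfl hij)
      · exact hlab s hi hs.labeled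
  · rintro ⟨hij, hnot⟩
    rcases mem_addRibbonShape.1 hij with hij | ⟨hia, hjb, -, -, -⟩
    · exact hij
    · by_contra hmem
      refine hnot ⟨?_, hjb, fun hse => ?_, fun i' hi' hlab => ?_⟩
      · by_contra hj
        exact hmem (T.shape.up_left_mem hia (by omega) (h.mem_of_label a c hq.labeled))
      · rcases mem_addRibbonShape.1 hse with hse | ⟨-, -, -, -, hse⟩
        · exact hmem (T.shape.up_left_mem (by omega) (by omega) hse)
        · exact hmem hse
      · exact hmem (T.shape.up_left_mem hi' le_rfl (h.mem_of_label i' j hlab))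

theorem right_mem_addRibbon_iff (h : IsLTLT n T) (hq : IsLabeledCorner T a c)
    (hs : IsSpecial T s b) : (a, c + 1) ∈ (addRibbon T a b).shape ↔ c < b := by
  refine ⟨fun hmem => ?_, fun hlt => mem_addRibbonShape.2 (Or.inr ⟨le_rfl, hlt, ?_, ?_, ?_⟩)⟩
  · rcases mem_addRibbonShape.1 hmem with hmem | ⟨-, hlt, -⟩
    · exact absurd hmem hq.right
    · exact hlt
  · exact T.shape.up_left_mem le_rfl (Nat.zero_le _) (h.mem_of_label a c hq.labeled)
  · exact T.shape.up_left_mem (Nat.zero_le _) hlt (h.mem_of_label s b hs.labeled)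
  · exact T.shape.up_left_mem (by omega) (by omega) (h.mem_of_label a c hq.labeled)

theorem rimLabeled_addRibbon (hs : IsSpecial T s b) : RimLabeled (addRibbon T a b) b := by
  refine ⟨s, fun hmem => ?_, hs.labeled⟩
  rcases mem_addRibbonShape.1 hmem with hmem | ⟨-, hlt, -⟩
  · exact hs.below (T.shape.up_left_mem le_rfl (by omega) hmem)
  · omega

theorem not_rimLabeled_addRibbon (h : IsLTLT n T) (hq : IsLabeledCorner T a c)
    (hs : IsSpecial T s b) {j : ℕ} (hcj : c < j) (hjb : j < b) :
    ¬ RimLabeled (addRibbon T a b) j := by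
  rintro ⟨i, hse, hlab⟩
  exact hse (mem_addRibbon_of_mem h hq hs (h.mem_of_label i j hlab) hcj hjb)

/-- The ribbon puts a box under every labeled column bottom in the columns after `c` up to `b`, and
beyond `b` there was none. -/
theorem IsSpecial.addRibbon (h : IsLTLT n T) (hq : IsLabeledCorner T a c)
    (hs : IsSpecial T s b) : IsSpecial (addRibbon T a b) a c := by
  refine ⟨hq.labeled, fun hmem => ?_, fun i j hcj hlab => ?_⟩
  · rcases mem_addRibbonShape.1 hmem with hmem | ⟨hlt, -⟩
    · exact hq.below hmem
    · omega
  · have hij := h.mem_of_label i j hlab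
    rcases Nat.lt_or_ge b j with hj | hj
    · exact mem_addRibbonShape.2 (Or.inl (hs.mem_below i j hj hlab))
    · have hia : i < a := by
        by_contra hia
        exact hq.right (T.shape.up_left_mem (by omega) (by omega) hij)
      refine mem_addRibbonShape.2 (Or.inr ⟨hia, hj, ?_, ?_, ?_⟩)
      · exact T.shape.up_left_mem hia (Nat.zero_le _) (h.mem_of_label a c hq.labeled)
      · exact h.mem_zero_of_labeled hlab
      · exact T.shape.up_left_mem (by omega) (by omega) hij

end AddRibbon

theorem eq_of_addRibbon_eq {T₁ T₂ : Tableau} {s₁ s₂ b₁ b₂ : ℕ} (h₁ : IsLTLT n T₁)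
    (h₂ : IsLTLT n T₂) (hq₁ : IsLabeledCorner T₁ a c) (hq₂ : IsLabeledCorner T₂ a c)
    (hs₁ : IsSpecial T₁ s₁ b₁) (hs₂ : IsSpecial T₂ s₂ b₂)
    (heq : addRibbon T₁ a b₁ = addRibbon T₂ a b₂) : T₁ = T₂ := by
  have hle₁ := hq₁.le_special hs₁
  have hle₂ := hq₂.le_special hs₂
  have hiff := right_mem_addRibbon_iff h₁ hq₁ hs₁
  rw [heq, right_mem_addRibbon_iff h₂ hq₂ hs₂] at hiff
  -- If `b₁ ≠ b₂`, the smaller one is a rim-labeled column strictly between `c` and the larger one,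
  -- which `not_rimLabeled_addRibbon` forbids; `hiff` rules out that just one of them equals `c`.
  have hb : b₁ = b₂ := by
    rcases lt_trichotomy b₁ b₂ with hlt | rfl | hlt
    · have := not_rimLabeled_addRibbon h₂ hq₂ hs₂ (hiff.1 (by omega)) hlt
      rw [← heq] at this
      exact absurd (rimLabeled_addRibbon hs₁) this
    · rfl
    · have := not_rimLabeled_addRibbon h₁ hq₁ hs₁ (hiff.2 (by omega)) hlt
      rw [heq] at this
      exact absurd (rimLabeled_addRibbon hs₂) this
  subst hb
  refine Tableau.ext ?_ (congrArg Tableau.box heq :) (congrArg Tableau.vEdge heq :)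
    (congrArg Tableau.hEdge heq :)
  ext ⟨i, j⟩
  rw [YoungDiagram.mem_cells, YoungDiagram.mem_cells, mem_iff_mem_addRibbon h₁ hq₁ hs₁, heq,
    ← mem_iff_mem_addRibbon h₂ hq₂ hs₂]

theorem IsLabeledCorner.addRibbon_self (hq : IsLabeledCorner T a c) (h : IsLTLT n T) :
    LTLT.addRibbon T a c = T := by
  refine Tableau.ext ?_ rfl rfl rfl
  ext ⟨i, j⟩
  rw [YoungDiagram.mem_cells, YoungDiagram.mem_cells]
  refine mem_addRibbonShape.trans ⟨?_, Or.inl⟩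
  rintro (hij | ⟨hi, hj, -⟩)
  · exact hij
  · exact T.shape.up_left_mem hi hj (h.mem_of_label a c hq.labeled)

/-! ### Removing the ribbon that starts at the special box. -/

section RemoveRibbon

open Classical in
/-- The shape of `T` without its ribbon from column `c` to column `b`. -/
noncomputable def removeRibbonShape (hs : IsSpecial T a c) (hb : RimLabeled T b) (hcb : c < b) :
    YoungDiagram where
  cells := T.shape.cells.filter fun p => ¬ InRibbon T c b p.1 p.2
  isLowerSet := by
    rintro ⟨i, j⟩ ⟨i', j'⟩ ⟨hi, hj⟩ hm
    simp only [Finset.coe_filter, YoungDiagram.mem_cells, Set.mem_ofPred_eq] at hm ⊢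
    dsimp only at hi hj
    obtain ⟨hij, hnot⟩ := hm
    refine ⟨T.shape.up_left_mem hi hj hij, ?_⟩
    rintro ⟨hcj, hjb, hse, hlab⟩
    -- A ribbon box has no box strictly Southeast of it, so only its own row and column matter.
    have hcases : i = i' ∨ j = j' := by
      by_contra hne
      exact hse (T.shape.up_left_mem (by omega) (by omega) hij)
    obtain ⟨k, hk, hklab⟩ := hb
    rcases hj.lt_or_eq with hlt | rfl
    · obtain rfl : i = i' := by omega
      have hbelow : ∀ k, i < k → ∀ m, j' < m → (k, m) ∉ T.shape := fun k hk m hm hmem =>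
        hse (T.shape.up_left_mem hk hm hmem)
      by_cases hjb' : j ≤ b
      · refine hnot ⟨by omega, hjb', hbelow _ (by omega) _ (by omega), fun i' hi' hl => ?_⟩
        have h1 := hs.mem_below i' j (by omega) hl
        exact hbelow _ (by omega) _ hlt h1
      -- Beyond column `b`, the rim-labeled box of column `b` must lie in row `i` or below, which no
      -- ribbon box of row `i` allows.
      · have hki : ¬ k < i := fun hki => hk (T.shape.up_left_mem hki (by omega) hij)
        rcases hjb.lt_or_eq with hjb | rfl
        · have h1 := hs.mem_below k b hcb hklab
          exact hbelow _ (by omega) _ hjb h1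
        · exact hlab k (by omega) hklab
    · refine hnot ⟨hcj, hjb, fun hmem => hse (T.shape.up_left_mem (by omega) le_rfl hmem),
        fun k hk => hlab k (by omega)⟩

theorem mem_removeRibbonShape (hs : IsSpecial T a c) (hb : RimLabeled T b) (hcb : c < b)
    {i j : ℕ} :
    (i, j) ∈ removeRibbonShape hs hb hcb ↔ (i, j) ∈ T.shape ∧ ¬ InRibbon T c b i j := by
  rw [← YoungDiagram.mem_cells]
  simp [removeRibbonShape]

theorem IsLTLT.not_inRibbon_zero (h : IsLTLT n T) {j : ℕ} (hj : (0, j) ∈ T.shape) :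
    ¬ InRibbon T c b 0 j := by
  rintro ⟨-, -, -, hlab⟩
  obtain ⟨i, hi⟩ := h.col_labeled j (YoungDiagram.mem_iff_lt_rowLen.1 hj)
  exact hlab i (Nat.zero_le _) hi

/-- `T` without its ribbon from column `c` to column `b`. -/
noncomputable def removeRibbon (hs : IsSpecial T a c) (hb : RimLabeled T b) (hcb : c < b) :
    Tableau :=
  { T with shape := removeRibbonShape hs hb hcb }

theorem IsLTLT.removeRibbon (h : IsLTLT n T) (hs : IsSpecial T a c) (hb : RimLabeled T b)
    (hcb : c < b) : IsLTLT n (LTLT.removeRibbon hs hb hcb) := by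
  refine h.of_shape _ ?_ ?_ fun i j hij => ?_
  · refine rowLen_eq_of_mem_iff fun j => ?_
    rw [mem_removeRibbonShape, ← YoungDiagram.mem_iff_lt_rowLen, and_iff_left_iff_imp]
    exact h.not_inRibbon_zero
  · refine colLen_eq_of_mem_iff fun j => ?_
    rw [mem_removeRibbonShape, ← YoungDiagram.mem_iff_lt_colLen, and_iff_left_iff_imp]
    rintro - ⟨h1, -⟩
    omega
  · exact (mem_removeRibbonShape hs hb hcb).2
      ⟨h.mem_of_label i j hij, fun hr => hr.2.2.2 i le_rfl hij⟩

theorem isLabeledCorner_removeRibbon (hs : IsSpecial T a c) (hb : RimLabeled T b) (hcb : c < b) :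
    IsLabeledCorner (removeRibbon hs hb hcb) a c := by
  refine ⟨hs.labeled, fun hmem => ?_, fun hmem => ?_⟩
  · exact hs.below ((mem_removeRibbonShape hs hb hcb).1 hmem).1
  · refine ((mem_removeRibbonShape hs hb hcb).1 hmem).2
      ⟨by omega, hcb, fun hse => ?_, fun i hi hlab => ?_⟩
    · exact hs.below (T.shape.up_left_mem le_rfl (by omega) hse)
    · exact hs.below (T.shape.up_left_mem (by omega) (by omega)
        (hs.mem_below i (c + 1) (by omega) hlab))

/-- The special box is the lowest labeled box of column `b`: a box directly below it would belong to
the removed ribbon. -/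
theorem IsLTLT.exists_isSpecial_removeRibbon (h : IsLTLT n T) (hs : IsSpecial T a c)
    (hb : RimLabeled T b) (hcb : c < b) :
    ∃ s, IsSpecial (LTLT.removeRibbon hs hb hcb) s b := by
  obtain ⟨k, hk, hklab⟩ := id hb
  have hbdd : ∀ i, Labeled T i b → i ≤ T.shape.colLen b := fun i hi =>
    (YoungDiagram.mem_iff_lt_colLen.1 (h.mem_of_label i b hi)).le
  have hmax : Labeled T (Nat.findGreatest (Labeled T · b) (T.shape.colLen b)) b :=
    Nat.findGreatest_spec (P := (Labeled T · b)) (hbdd k hklab) hklab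
  have hle : ∀ i, Labeled T i b → i ≤ Nat.findGreatest (Labeled T · b) (T.shape.colLen b) :=
    fun i hi => Nat.le_findGreatest (P := (Labeled T · b)) (hbdd i hi) hi
  generalize Nat.findGreatest (Labeled T · b) (T.shape.colLen b) = s at hmax hle
  refine ⟨s, hmax, fun hmem => ?_, fun i j hj hlab => ?_⟩
  · refine ((mem_removeRibbonShape hs hb hcb).1 hmem).2
      ⟨hcb, le_rfl, fun hse => hk ?_, fun i hi hlab => ?_⟩
    · have := hle k hklab
      exact T.shape.up_left_mem (by omega) le_rfl hse
    · have := hle i hlab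
      omega
  · refine (mem_removeRibbonShape hs hb hcb).2
      ⟨hs.mem_below i j (by omega) hlab, fun hr => ?_⟩
    have := hr.2.1
    omega

theorem addRibbon_removeRibbon (h : IsLTLT n T) (hs : IsSpecial T a c) (hb : RimLabeled T b)
    (hcb : c < b) (hright : (a, c + 1) ∈ T.shape)
    (hmin : ∀ j, c < j → j < b → ¬ RimLabeled T j) :
    addRibbon (removeRibbon hs hb hcb) a b = T := by
  refine Tableau.ext ?_ rfl rfl rfl
  ext ⟨i, j⟩
  rw [YoungDiagram.mem_cells, YoungDiagram.mem_cells]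
  refine mem_addRibbonShape.trans ?_
  simp only [removeRibbon, mem_removeRibbonShape]
  constructor
  · rintro (hij | ⟨hia, hjb, hi0, h0j, hse, hnot⟩)
    · exact hij.1
    · by_contra hmem
      have hac := h.mem_of_label a c hs.labeled
      have hj : c + 1 < j := by
        by_contra hj
        exact hmem (T.shape.up_left_mem hia (by omega) hright)
      have hi : 0 < i := by
        rcases Nat.eq_zero_or_pos i with rfl | hi
        · exact absurd h0j.1 hmem
        · exact hi
      -- If `(i, j)` were outside `T`, its Northwest neighbor would be a ribbon box: a label at or
      -- below that neighbor would make column `j - 1` rim-labeled, against the minimality of `b`.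
      refine hnot ⟨by omega, by omega, ?_, fun k hk hlab => hmin (j - 1) (by omega) (by omega)
        ⟨k, ?_, hlab⟩⟩
      · rwa [Nat.sub_add_cancel hi, Nat.sub_add_cancel (by omega)]
      · rw [Nat.sub_add_cancel (by omega)]
        exact fun hk' => hmem (T.shape.up_left_mem (by omega) le_rfl hk')
  · intro hij
    by_cases hr : InRibbon T c b i j
    · obtain ⟨hcj, hjb, -, -⟩ := id hr
      have h0j := T.shape.up_left_mem (Nat.zero_le _) le_rfl hij
      have hi : 0 < i := by
        rcases Nat.eq_zero_or_pos i with rfl | hi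
        · exact absurd hr (h.not_inRibbon_zero hij)
        · exact hi
      refine Or.inr ⟨?_, hjb, ⟨T.shape.up_left_mem le_rfl (Nat.zero_le _) hij, ?_⟩,
        ⟨h0j, h.not_inRibbon_zero h0j⟩, T.shape.up_left_mem (by omega) (by omega) hij, ?_⟩
      · by_contra hia
        exact hs.below (T.shape.up_left_mem (by omega) hcj.le hij)
      · rintro ⟨hc0, -⟩
        omega
      · rintro ⟨-, -, hse, -⟩
        rw [Nat.sub_add_cancel hi, Nat.sub_add_cancel (by omega)] at hse
        exact hse hij
    · exact Or.inl ⟨hij, hr⟩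

end RemoveRibbon

theorem IsLTLT.exists_addRibbon_eq (h : IsLTLT n T) :
    ∃ T₀ a c, IsLTLT n T₀ ∧ IsLabeledCorner T₀ a c ∧
      LTLT.addRibbon T₀ a (specialColumn T₀) = T := by
  classical
  have hs := h.isSpecial_specialBox
  generalize (specialBox T).1 = a at hs
  generalize (specialBox T).2 = c at hs
  by_cases hright : (a, c + 1) ∈ T.shape
  · have hlast : c < T.shape.rowLen 0 - 1 := by
      have := YoungDiagram.mem_iff_lt_rowLen.1
        (T.shape.up_left_mem (Nat.zero_le _) le_rfl hright)
      omega
    -- The last column qualifies: nothing lies to the right of its labeled boxes.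
    have hex : ∃ j, c < j ∧ RimLabeled T j := by
      obtain ⟨i, hi⟩ := h.col_labeled (T.shape.rowLen 0 - 1) (by omega)
      refine ⟨_, hlast, i, fun hse => ?_, hi⟩
      have := YoungDiagram.mem_iff_lt_rowLen.1
        (T.shape.up_left_mem (Nat.zero_le _) le_rfl hse)
      omega
    obtain ⟨hcb, hb⟩ := Nat.find_spec hex
    have hmin : ∀ j, c < j → j < Nat.find hex → ¬ RimLabeled T j := fun j hj hlt hr =>
      Nat.find_min hex hlt ⟨hj, hr⟩
    obtain ⟨s, hs'⟩ := h.exists_isSpecial_removeRibbon hs hb hcb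
    refine ⟨_, a, c, h.removeRibbon hs hb hcb, isLabeledCorner_removeRibbon hs hb hcb, ?_⟩
    rw [hs'.specialColumn_eq (h.removeRibbon hs hb hcb),
      addRibbon_removeRibbon h hs hb hcb hright hmin]
  · have hq : IsLabeledCorner T a c := ⟨hs.labeled, hs.below, hright⟩
    exact ⟨T, a, c, h, hq, by rw [hs.specialColumn_eq h, hq.addRibbon_self h]⟩

end Ribbons

/-! ### Reflection in the diagonal, which reduces rows to columns. -/

section Transpose

variable {n a c : ℕ} {T : Tableau} {x y : Label}

/-- The label that replaces a label when a tableau is reflected in its main diagonal. -/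
def Label.mirror : Label → Label
  | .one => .one
  | .alpha => .beta
  | .beta => .alpha
  | .gamma => .delta
  | .delta => .gamma

theorem Label.mirror_mirror (l : Label) : l.mirror.mirror = l := by cases l <;> rfl

theorem Label.mirror_eq_iff {l l' : Label} : l.mirror = l' ↔ l = l'.mirror := by
  cases l <;> cases l' <;> simp [mirror]

theorem map_mirror_eq_some {o : Option Label} {l : Label} :
    o.map Label.mirror = some l ↔ o = some l.mirror := by
  cases o <;> simp [Label.mirror_eq_iff]

theorem map_mirror_map_mirror (o : Option Label) :
    (o.map Label.mirror).map Label.mirror = o := by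
  cases o <;> simp [Label.mirror_mirror]

/-- The reflection of a tableau in its main diagonal. -/
def Tableau.transpose (T : Tableau) : Tableau where
  shape := T.shape.transpose
  box i j := (T.box j i).map Label.mirror
  vEdge i := (T.hEdge i).map Label.mirror
  hEdge j := (T.vEdge j).map Label.mirror

theorem Tableau.transpose_transpose (T : Tableau) : T.transpose.transpose = T := by
  simp only [Tableau.transpose, map_mirror_map_mirror, YoungDiagram.transpose_transpose]

theorem IsLTLT.transpose (h : IsLTLT n T) : IsLTLT n T.transpose := by
  have hone : ∀ l : Label, l.mirror = .one ↔ l = .one := fun _ => Label.mirror_eq_iff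
  constructor <;>
    simp only [Tableau.transpose, YoungDiagram.colLen_transpose, YoungDiagram.rowLen_transpose,
      Option.isSome_map, map_mirror_eq_some, Option.map_eq_none_iff, YoungDiagram.mem_transpose,
      Prod.swap_prod_mk, ne_eq]
  · rw [add_comm, h.halfPerimeter]
  · exact fun i j => h.mem_of_label j i
  · exact h.hEdge_isSome
  · exact h.vEdge_isSome
  · exact h.root
  · intro i j l hl
    rw [← hone l, h.box_one _ _ _ hl, or_comm]
  · intro i l hl
    rw [← hone l, h.hEdge_one _ _ hl]
  · intro i l hl
    rw [← hone l, h.vEdge_one _ _ hl]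
  · exact h.col_labeled
  · exact h.row_labeled
  · exact fun i j => h.box_beta_delta j i
  · exact fun i j => h.box_alpha_gamma j i
  · exact h.hEdge_ne
  · exact h.vEdge_ne

theorem IsLabeledCorner.transpose (h : IsLabeledCorner T a c) :
    IsLabeledCorner T.transpose c a := by
  refine ⟨?_, ?_, ?_⟩
  · simpa [Labeled, Tableau.transpose] using h.labeled
  · simpa [Tableau.transpose, YoungDiagram.mem_transpose] using h.right
  · simpa [Tableau.transpose, YoungDiagram.mem_transpose] using h.below

theorem addRowShape_eq (μ : YoungDiagram) (c : ℕ) :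
    addRowShape μ c = (addColumnShape μ.transpose c).transpose := by
  ext ⟨i, j⟩
  rw [YoungDiagram.mem_cells, YoungDiagram.mem_cells, YoungDiagram.mem_transpose,
    ← YoungDiagram.mem_cells, ← YoungDiagram.mem_cells]
  simp only [addRowShape, addColumnShape, Finset.mem_union, YoungDiagram.mem_cells,
    Finset.mem_image, Finset.mem_range, Prod.mk.injEq, Prod.swap_prod_mk,
    YoungDiagram.mem_transpose, YoungDiagram.rowLen_transpose, and_comm]

theorem mem_addRowShape {μ : YoungDiagram} {i j : ℕ} :
    (i, j) ∈ addRowShape μ c ↔ i < μ.colLen j + if j ≤ c then 1 else 0 := by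
  rw [addRowShape_eq, YoungDiagram.mem_transpose, Prod.swap_prod_mk, mem_addColumnShape,
    YoungDiagram.rowLen_transpose]

theorem addRow_eq (T : Tableau) (c : ℕ) (x y : Label) :
    addRow T c x y = (addColumn T.transpose c y.mirror x.mirror).transpose := by
  ext1
  · exact addRowShape_eq _ _
  · funext i j
    simp only [addRow, addColumn, Tableau.transpose, YoungDiagram.rowLen_transpose]
    split_ifs <;> simp only [map_mirror_map_mirror, Option.map_none]
  · funext i
    simp only [addRow, addColumn, Tableau.transpose, YoungDiagram.rowLen_transpose]
    split_ifs <;> simp only [map_mirror_map_mirror, Option.map_some, Label.mirror_mirror]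
  · funext j
    simp only [addRow, addColumn, Tableau.transpose]
    split_ifs <;> simp only [map_mirror_map_mirror, Option.map_some, Label.mirror_mirror]

theorem compatible_horiz_iff :
    Compatible (.horiz c) (x, y) ↔ Compatible (.vert c) (y.mirror, x.mirror) := by
  cases c <;> cases x <;> cases y <;> simp [Compatible, Label.mirror]

/-- Merges the cases of the first row and of the other rows into the hypotheses of
`IsLTLT.addColumn`. -/
theorem compatible_vert_iff :
    Compatible (.vert a) (x, y) ↔
      (x = .one ↔ a = 0) ∧ x ≠ .beta ∧ x ≠ .delta ∧ (y = .beta ∨ y = .delta) := by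
  cases a <;> cases x <;> simp [Compatible]

theorem Tableau.colLen_transpose (T : Tableau) (j : ℕ) :
    T.transpose.shape.colLen j = T.shape.rowLen j := YoungDiagram.colLen_transpose _ _

theorem Tableau.rowLen_transpose (T : Tableau) (i : ℕ) :
    T.transpose.shape.rowLen i = T.shape.colLen i := YoungDiagram.rowLen_transpose _ _

theorem IsLTLT.exists_addColumn_eq {l : Label} (h : IsLTLT (n + 1) T)
    (hq : IsLabeledCorner T a c) (hl : T.box a c = some l) (hc : 0 < c) (hb : l ≠ .beta)
    (hd : l ≠ .delta) : ∃ T₀ x y, IsLTLT n T₀ ∧ a < T₀.shape.colLen 0 ∧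
      Compatible (.vert a) (x, y) ∧ LTLT.addColumn T₀ a x y = T ∧ T₀.shape.rowLen a = c := by
  have hac := h.mem_of_label a c hq.labeled
  have ha : a < T.shape.colLen 0 :=
    YoungDiagram.mem_iff_lt_colLen.1 (T.shape.up_left_mem le_rfl (Nat.zero_le _) hac)
  have hc' : c < T.shape.rowLen 0 :=
    YoungDiagram.mem_iff_lt_rowLen.1 (T.shape.up_left_mem (Nat.zero_le _) le_rfl hac)
  obtain ⟨x, hx⟩ := Option.isSome_iff_exists.1 ((h.vEdge_isSome a).2 ha)
  obtain ⟨y, hy⟩ := Option.isSome_iff_exists.1 ((h.hEdge_isSome c).2 hc')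
  refine ⟨LTLT.deleteColumn T a c, x, y, h.deleteColumn hq hl hc hb hd, ?_,
    compatible_vert_iff.2 ⟨h.vEdge_one a x hx, ?_, ?_, ?_⟩,
    h.addColumn_deleteColumn hq hl hc hb hd hx hy, h.rowLen_deleteColumn hq⟩
  · exact (colLen_zero_deleteColumnShape hc).symm ▸ ha
  · rintro rfl
    exact (h.vEdge_ne a).1 hx
  · rintro rfl
    exact (h.vEdge_ne a).2 hx
  · have h1 := h.hEdge_one c y hy
    have h2 := h.hEdge_ne c
    cases y <;> simp_all

theorem IsLTLT.addColumn_inj {T' : Tableau} {r : ℕ} {x' y' : Label} (h : IsLTLT n T)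
    (h' : IsLTLT n T') (hlen : T.shape.rowLen r = T'.shape.rowLen r)
    (heq : LTLT.addColumn T r x y = LTLT.addColumn T' r x' y') : T = T' ∧ x = x' ∧ y = y' := by
  refine ⟨?_, ?_, ?_⟩
  · rw [← h.deleteColumn_addColumn r x y, heq, hlen, h'.deleteColumn_addColumn]
  · simpa [LTLT.addColumn] using congrFun (congrArg Tableau.vEdge heq) r
  · simpa [LTLT.addColumn, hlen] using congrFun (congrArg Tableau.hEdge heq) (T.shape.rowLen r)

theorem IsLTLT.addRow_inj {T' : Tableau} {x' y' : Label} (h : IsLTLT n T)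
    (h' : IsLTLT n T') (hlen : T.shape.colLen c = T'.shape.colLen c)
    (heq : addRow T c x y = addRow T' c x' y') : T = T' ∧ x = x' ∧ y = y' := by
  rw [addRow_eq, addRow_eq] at heq
  have heq' := congrArg Tableau.transpose heq
  rw [Tableau.transpose_transpose, Tableau.transpose_transpose] at heq'
  obtain ⟨h1, h2, h3⟩ := h.transpose.addColumn_inj h'.transpose
    (by rwa [Tableau.rowLen_transpose, Tableau.rowLen_transpose]) heq'
  refine ⟨?_, ?_, ?_⟩
  · rw [← T.transpose_transpose, h1, T'.transpose_transpose]
  · rw [← x.mirror_mirror, h3, x'.mirror_mirror]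
  · rw [← y.mirror_mirror, h2, y'.mirror_mirror]

end Transpose

/-! ### The two stages of insertion, and their composite. -/

section Insertion

variable {n : ℕ} {T : Tableau} {e : Edge} {xy : Label × Label}

/-- The first step of the insertion algorithm: column or row addition at a border edge. -/
def addAtEdge (T : Tableau) (e : Edge) (xy : Label × Label) : Tableau :=
  match e with
  | .vert r => addColumn T r xy.1 xy.2
  | .horiz c => addRow T c xy.1 xy.2

/-- The labeled box that is created by column or row addition at a border edge. -/
def newBox (T : Tableau) (e : Edge) : ℕ × ℕ :=
  match e with
  | .vert r => (r, T.shape.rowLen r)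
  | .horiz c => (T.shape.colLen c, c)

theorem IsLTLT.addAtEdge (h : IsLTLT n T) (he : IsBorderEdge T.shape e) (hxy : Compatible e xy) :
    IsLTLT (n + 1) (addAtEdge T e xy) := by
  obtain ⟨x, y⟩ := xy
  cases e with
  | vert r =>
    obtain ⟨h1, h2, h3, h4⟩ := compatible_vert_iff.1 hxy
    exact h.addColumn he h1 h2 h3 h4
  | horiz c =>
    obtain ⟨h1, h2, h3, h4⟩ := compatible_vert_iff.1 (compatible_horiz_iff.1 hxy)
    simp only [LTLT.addAtEdge, addRow_eq]
    exact (h.transpose.addColumn (T.colLen_transpose 0 ▸ he) h1 h2 h3 h4).transpose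

theorem IsLTLT.isLabeledCorner_addAtEdge (h : IsLTLT n T) (he : IsBorderEdge T.shape e) :
    IsLabeledCorner (LTLT.addAtEdge T e xy) (newBox T e).1 (newBox T e).2 := by
  cases e with
  | vert r => exact h.isLabeledCorner_addColumn _ _ he
  | horiz c =>
    simp only [LTLT.addAtEdge, addRow_eq, newBox]
    rw [← T.rowLen_transpose]
    exact (h.transpose.isLabeledCorner_addColumn _ _ (T.colLen_transpose 0 ▸ he)).transpose

theorem box_newBox_vert (T : Tableau) (r : ℕ) (xy : Label × Label) :
    (LTLT.addAtEdge T (.vert r) xy).box (newBox T (.vert r)).1 (newBox T (.vert r)).2 =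
      T.vEdge r := by
  simp [LTLT.addAtEdge, newBox, LTLT.addColumn]

theorem box_newBox_horiz (T : Tableau) (c : ℕ) (xy : Label × Label) :
    (LTLT.addAtEdge T (.horiz c) xy).box (newBox T (.horiz c)).1 (newBox T (.horiz c)).2 =
      T.hEdge c := by
  simp [LTLT.addAtEdge, newBox, addRow]

/-- The new box inherits an edge label, and `1` is the only one that both kinds of edges can carry.
It would force `r = 0`, whereas an added row is never the first. -/
theorem IsLTLT.newBox_vert_ne_horiz {T' : Tableau} {r c : ℕ} {xy xy' : Label × Label}
    (h : IsLTLT n T) (h' : IsLTLT n T') (hr : IsBorderEdge T.shape (.vert r))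
    (hc : IsBorderEdge T'.shape (.horiz c))
    (heq : LTLT.addAtEdge T (.vert r) xy = LTLT.addAtEdge T' (.horiz c) xy') :
    newBox T (.vert r) ≠ newBox T' (.horiz c) := by
  intro hbox
  have hlab := box_newBox_vert T r xy
  rw [heq, hbox, box_newBox_horiz] at hlab
  obtain ⟨l, hl⟩ := Option.isSome_iff_exists.1 ((h.vEdge_isSome r).2 hr)
  have h1 := h.vEdge_ne r
  have h2 := h'.hEdge_ne c
  have h3 := h.vEdge_one r l hl
  rw [hlab] at h2
  rw [hl] at h1 h2
  have hl1 : l = .one := by cases l <;> simp_all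
  have hr0 : r = T'.shape.colLen c := congrArg Prod.fst hbox
  have hpos : 0 < T'.shape.colLen c :=
    YoungDiagram.mem_iff_lt_colLen.1 (YoungDiagram.mem_iff_lt_rowLen.2 hc)
  have := h3.1 hl1
  omega

theorem IsLTLT.addAtEdge_inj {T' : Tableau} {e' : Edge} {xy' : Label × Label} (h : IsLTLT n T)
    (h' : IsLTLT n T') (he : IsBorderEdge T.shape e) (he' : IsBorderEdge T'.shape e')
    (heq : LTLT.addAtEdge T e xy = LTLT.addAtEdge T' e' xy') (hbox : newBox T e = newBox T' e') :
    (T, e, xy) = (T', e', xy') := by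
  obtain ⟨x, y⟩ := xy
  obtain ⟨x', y'⟩ := xy'
  cases e with
  | vert r =>
    cases e' with
    | vert r' =>
      obtain ⟨rfl, hlen⟩ := Prod.mk.inj hbox
      obtain ⟨rfl, rfl, rfl⟩ := h.addColumn_inj h' hlen heq
      rfl
    | horiz c => exact absurd hbox (h.newBox_vert_ne_horiz h' he he' heq)
  | horiz c =>
    cases e' with
    | vert r => exact absurd hbox.symm (h'.newBox_vert_ne_horiz h he' he heq.symm)
    | horiz c' =>
      obtain ⟨hlen, rfl⟩ := Prod.mk.inj hbox
      obtain ⟨rfl, rfl, rfl⟩ := h.addRow_inj h' hlen heq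
      rfl

theorem IsLTLT.exists_addAtEdge_eq {a c : ℕ} (hn : 1 ≤ n) (h : IsLTLT (n + 1) T)
    (hq : IsLabeledCorner T a c) : ∃ p ∈ insertionInputs n,
      LTLT.addAtEdge p.1 p.2.1 p.2.2 = T ∧ newBox p.1 p.2.1 = (a, c) := by
  obtain ⟨l, hl⟩ := Option.isSome_iff_exists.1 hq.labeled
  have hone := h.box_one a c l hl
  by_cases hcol : 0 < c ∧ l ≠ .beta ∧ l ≠ .delta
  · obtain ⟨T₀, x, y, h1, h2, h3, h4, h5⟩ :=
      h.exists_addColumn_eq hq hl hcol.1 hcol.2.1 hcol.2.2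
    exact ⟨(T₀, .vert a, (x, y)), ⟨h1, h2, h3⟩, h4, by rw [newBox, h5]⟩
  -- A corner in row `0` that column deletion does not handle is the root. The diagram would then be
  -- a single box, of half-perimeter `2 < n + 2`.
  · have ha : 0 < a := by
      rcases Nat.eq_zero_or_pos a with rfl | ha
      · have hl1 : l = .one := hone.2 (Or.inl rfl)
        obtain rfl : c = 0 := by
          by_contra hc
          exact hcol ⟨by omega, by simp [hl1], by simp [hl1]⟩
        have h1 := hq.below
        have h2 := hq.right
        rw [YoungDiagram.mem_iff_lt_colLen] at h1
        rw [YoungDiagram.mem_iff_lt_rowLen] at h2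
        have := h.halfPerimeter
        omega
      · exact ha
    have hlm : l.mirror ≠ .beta ∧ l.mirror ≠ .delta := by
      have : ¬ (l = .alpha ∨ l = .gamma) := by
        intro hl'
        have hc : ¬ c = 0 := fun hc => by
          have := hone.2 (Or.inr hc)
          subst this
          simp at hl'
        refine hcol ⟨by omega, ?_⟩
        rcases hl' with rfl | rfl <;> simp
      cases l <;> simp_all [Label.mirror]
    obtain ⟨T₀, x, y, h1, h2, h3, h4, h5⟩ := h.transpose.exists_addColumn_eq hq.transpose
      (l := l.mirror) (by simp [Tableau.transpose, hl]) ha hlm.1 hlm.2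
    refine ⟨(T₀.transpose, .horiz c, (y.mirror, x.mirror)), ⟨h1.transpose, ?_, ?_⟩, ?_, ?_⟩
    · exact h2.trans_eq (T₀.rowLen_transpose 0).symm
    · rw [compatible_horiz_iff, Label.mirror_mirror, Label.mirror_mirror]
      exact h3
    · simp only [LTLT.addAtEdge, addRow_eq, Label.mirror_mirror, Tableau.transpose_transpose, h4]
    · simp only [newBox, Tableau.colLen_transpose, h5]

/-- Labels right of both the new column and the old special box stay above a box. So the special box
is the further right of the new box and the shifted old one. The special box is not symmetric under
reflection, so rows need their own proof. -/
theorem IsLTLT.isSpecial_addColumn {r s b : ℕ} {x y : Label} (h : IsLTLT n T)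
    (hs : IsSpecial T s b) (hr : r < T.shape.colLen 0) :
    if T.shape.rowLen r ≤ b then IsSpecial (LTLT.addColumn T r x y) s (b + 1)
    else IsSpecial (LTLT.addColumn T r x y) r (T.shape.rowLen r) := by
  have key : ∀ i j, T.shape.rowLen r < j → b + 1 < j ∨ b < T.shape.rowLen r →
      Labeled (LTLT.addColumn T r x y) i j →
      (i + 1, j) ∈ (LTLT.addColumn T r x y).shape := by
    intro i j hj hbj hlab
    rw [Labeled, LTLT.addColumn] at hlab
    simp only [if_neg (show ¬ j < T.shape.rowLen r by omega),
      if_neg (show ¬ j = T.shape.rowLen r by omega)] at hlab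
    have hmem := hs.mem_below i (j - 1) (by omega) hlab
    rw [YoungDiagram.mem_iff_lt_rowLen] at hmem
    refine mem_addColumnShape.2 ?_
    split_ifs with hi
    · omega
    · have := T.shape.rowLen_anti r (i + 1) (by omega)
      omega
  split_ifs with hle
  · refine ⟨?_, fun hmem => ?_, fun i j hj => key i j (by omega) (by omega)⟩
    · rw [Labeled, LTLT.addColumn]
      simp only [if_neg (show ¬ b + 1 < T.shape.rowLen r by omega),
        if_neg (show ¬ b + 1 = T.shape.rowLen r by omega)]
      exact hs.labeled
    · have h1 := mem_addColumnShape.1 hmem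
      have h2 := hs.below
      rw [YoungDiagram.mem_iff_lt_rowLen] at h2
      split_ifs at h1 <;> omega
  · have hq := h.isLabeledCorner_addColumn x y hr
    exact ⟨hq.labeled, hq.below, fun i j hj => key i j hj (by omega)⟩

theorem IsLTLT.isSpecial_addRow {c s b : ℕ} {x y : Label} (h : IsLTLT n T)
    (hs : IsSpecial T s b) (hc : c < T.shape.rowLen 0) :
    if c < b then IsSpecial (addRow T c x y) s b
    else IsSpecial (addRow T c x y) (T.shape.colLen c) c := by
  have key : ∀ i j, c < j → b < j → Labeled (addRow T c x y) i j →
      (i + 1, j) ∈ (addRow T c x y).shape := by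
    intro i j hcj hbj hlab
    have hanti := T.shape.colLen_anti c j hcj.le
    -- Columns to the right of `c` have no labels in the inserted row or below it.
    have hlt : i < T.shape.colLen c := by
      by_contra hlt
      rw [Labeled, addRow] at hlab
      simp only [if_neg hlt, if_neg hcj.ne'] at hlab
      split_ifs at hlab
      · simp at hlab
      · have := YoungDiagram.mem_iff_lt_colLen.1 (h.mem_of_label _ _ hlab)
        omega
    rw [Labeled, addRow] at hlab
    simp only [if_pos hlt] at hlab
    have hmem := hs.mem_below i j hbj hlab
    rw [YoungDiagram.mem_iff_lt_colLen] at hmem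
    exact mem_addRowShape.2 (by omega)
  split_ifs with hlt
  · have hlen := h.colLen_of_labeled hs.labeled hs.below
    have hanti := T.shape.colLen_anti c b hlt.le
    refine ⟨?_, fun hmem => ?_, fun i j hj => key i j (by omega) hj⟩
    · rw [Labeled, addRow]
      simp only [if_pos (show s < T.shape.colLen c by omega)]
      exact hs.labeled
    · have h1 := mem_addRowShape.1 hmem
      rw [if_neg (by omega)] at h1
      omega
  · have hq := h.isLabeledCorner_addAtEdge (e := .horiz c) (xy := (x, y)) hc
    exact ⟨hq.labeled, hq.below, fun i j hj => key i j hj (by omega)⟩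

theorem IsLTLT.insertion_eq (h : IsLTLT n T) (he : IsBorderEdge T.shape e)
    (hxy : Compatible e xy) : insertion T e xy =
      LTLT.addRibbon (LTLT.addAtEdge T e xy) (newBox T e).1
        (specialColumn (LTLT.addAtEdge T e xy)) := by
  have hs := h.isSpecial_specialBox
  have h' := h.addAtEdge he hxy
  have hq := h.isLabeledCorner_addAtEdge (xy := xy) he
  cases e with
  | vert r =>
    have hspec := h.isSpecial_addColumn (x := xy.1) (y := xy.2) hs he
    by_cases hle : T.shape.rowLen r ≤ (specialBox T).2
    · rw [if_pos hle] at hspec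
      rw [IsSpecial.specialColumn_eq h' hspec]
      exact if_pos hle
    · rw [if_neg hle] at hspec
      rw [IsSpecial.specialColumn_eq h' hspec]
      exact (if_neg hle).trans (hq.addRibbon_self h').symm
  | horiz c =>
    have hspec := h.isSpecial_addRow (x := xy.1) (y := xy.2) hs he
    by_cases hlt : c < (specialBox T).2
    · rw [if_pos hlt] at hspec
      rw [IsSpecial.specialColumn_eq h' hspec]
      exact if_pos hlt
    · rw [if_neg hlt] at hspec
      rw [IsSpecial.specialColumn_eq h' hspec]
      exact (if_neg hlt).trans (hq.addRibbon_self h').symm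

theorem IsLTLT.isSpecial_specialColumn (h : IsLTLT n T) :
    ∃ s, IsSpecial T s (specialColumn T) := ⟨_, h.isSpecial_specialBox⟩

theorem mapsTo_insertion (n : ℕ) :
    Set.MapsTo (fun p : Tableau × Edge × (Label × Label) => insertion p.1 p.2.1 p.2.2)
      (insertionInputs n) {T' | IsLTLT (n + 1) T'} := by
  rintro ⟨T, e, xy⟩ ⟨h, he, hxy⟩
  change IsLTLT _ (insertion T e xy)
  rw [h.insertion_eq he hxy]
  exact (h.addAtEdge he hxy).addRibbon _ _

theorem injOn_insertion (n : ℕ) :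
    Set.InjOn (fun p : Tableau × Edge × (Label × Label) => insertion p.1 p.2.1 p.2.2)
      (insertionInputs n) := by
  rintro ⟨T₁, e₁, xy₁⟩ ⟨h₁, he₁, hxy₁⟩ ⟨T₂, e₂, xy₂⟩ ⟨h₂, he₂, hxy₂⟩ heq
  change insertion T₁ e₁ xy₁ = insertion T₂ e₂ xy₂ at heq
  rw [h₁.insertion_eq he₁ hxy₁, h₂.insertion_eq he₂ hxy₂] at heq
  have hA₁ := h₁.addAtEdge he₁ hxy₁
  have hA₂ := h₂.addAtEdge he₂ hxy₂
  have hq₁ := h₁.isLabeledCorner_addAtEdge (xy := xy₁) he₁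
  have hq₂ := h₂.isLabeledCorner_addAtEdge (xy := xy₂) he₂
  obtain ⟨s₁, hs₁⟩ := hA₁.isSpecial_specialColumn
  obtain ⟨s₂, hs₂⟩ := hA₂.isSpecial_specialColumn
  -- Both new boxes are the special box of the common result.
  have hbox : newBox T₁ e₁ = newBox T₂ e₂ := by
    have hb₁ := (IsSpecial.addRibbon hA₁ hq₁ hs₁).specialBox_eq (hA₁.addRibbon _ _)
    have hb₂ := (IsSpecial.addRibbon hA₂ hq₂ hs₂).specialBox_eq (hA₂.addRibbon _ _)
    rw [heq, hb₂] at hb₁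
    exact hb₁.symm
  rw [← hbox] at hq₂ heq
  exact h₁.addAtEdge_inj h₂ he₁ he₂ (eq_of_addRibbon_eq hA₁ hA₂ hq₁ hq₂ hs₁ hs₂ heq) hbox

theorem surjOn_insertion {n : ℕ} (hn : 1 ≤ n) :
    Set.SurjOn (fun p : Tableau × Edge × (Label × Label) => insertion p.1 p.2.1 p.2.2)
      (insertionInputs n) {T' | IsLTLT (n + 1) T'} := by
  intro T' (h : IsLTLT (n + 1) T')
  obtain ⟨T, a, c, hT, hq, rfl⟩ := h.exists_addRibbon_eq
  obtain ⟨p, hp, rfl, hbox⟩ := hT.exists_addAtEdge_eq hn hq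
  refine ⟨p, hp, ?_⟩
  change insertion p.1 p.2.1 p.2.2 = _
  rw [hp.1.insertion_eq hp.2.1 hp.2.2, hbox]

end Insertion

end LTLT

theorem proposition2 (n : ℕ) (hn : 1 ≤ n) :
    Set.BijOn (fun p : LTLT.Tableau × LTLT.Edge × (LTLT.Label × LTLT.Label) =>
        LTLT.insertion p.1 p.2.1 p.2.2)
      (LTLT.insertionInputs n) {T' : LTLT.Tableau | LTLT.IsLTLT (n + 1) T'} :=
  ⟨LTLT.mapsTo_insertion n, LTLT.injOn_insertion n, LTLT.surjOn_insertion hn⟩
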